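/- Let $\mathbb F$ be a finite field, let $n\ge 1$ be coprime to $|\mathbb F|$, let $A=\mathbb F[x]/\langle x^n-1\rangle$, and let $\sigma$ be an $\mathbb F$-algebra automorphism of $A$. Let $A[z;\sigma]$ be the skew-polynomial ring whose elements are the polynomials $\sum_j z^ja_j$ with $a_j\in A$, with the usual addition and with multiplication determined by $az=z\sigma(a)$ for $a\in A$. It is a left module over its subring $\mathbb F[z]$. Write $x^n-1=\pi_1\cdots\pi_r$ with pairwise different monic irreducible $\pi_k\in\mathbb F[x]$, and let $\varepsilon_k\in A$ be the idempotent with $\varepsilon_k\equiv 1 \bmod \pi_k$ and $\varepsilon_k\equiv 0\bmod \pi_l$ for $l\neq k$. For $f\in A[z;\sigma]$ put $f^{(k)}=\varepsilon_kf$ and $T_f=\{k\in\{1,\dots,r\}\mid f^{(k)}\neq 0\}$, and let $\langle f\rangle=A[z;\sigma]f$ be the left ideal generated by $f$. Let $\mathfrak p:\mathbb F[z]^n\to A[z;\sigma]$ be the $\mathbb F[z]$-linear isomorphism that sends $\sum_j z^j(v_{j,0},\dots,v_{j,n-1})$ to $\sum_j z^j\sum_{i=0}^{n-1}v_{j,i}x^i$.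 A submodule $\mathcal S\subseteq\mathbb F[z]^n$ is called $\sigma$-cyclic if $\mathfrak p(\mathcal S)$ is a left ideal of $A[z;\sigma]$, and a $\sigma$-cyclic convolutional code is a $\sigma$-cyclic submodule of $\mathbb F[z]^n$ that is a direct summand of the $\mathbb F[z]$-module $\mathbb F[z]^n$. Let $\mathcal I$ be a left ideal of $A[z;\sigma]$. Then the following are equivalent: (i) $\mathcal I$ is a direct summand of the left $\mathbb F[z]$-module $A[z;\sigma]$; (ii) $\mathcal I$ is a direct summand of the left $A[z;\sigma]$-module $A[z;\sigma]$. In particular, every $\sigma$-cyclic convolutional code $\mathcal C\subseteq\mathbb F[z]^n$ has a direct complement in $\mathbb F[z]^n$ that is again a $\sigma$-cyclic convolutional code. Furthermore, if $\mathcal I$ is a direct summand, then there are a unit $u\in A[z;\sigma]$ and an element $g\in A[z;\sigma]$ with $\mathcal I=\langle g\rangle$ and $g=\sum_{l\in T_g}u^{(l)}$. For all such $u$ and $g$, the left ideal $\langle g'\rangle$ with $g'=\sum_{l\notin T_g}u^{(l)}$ is a direct complement of $\mathcal I$, that is, $A[z;\sigma]=\mathcal I\oplus\langle g'\rangle$.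 -/

import Mathlib

open Polynomial

noncomputable section

namespace Piret

section SkewPoly

variable {F A : Type*} [Field F] [CommRing A] [Algebra F A]

/-- The carrier of the skew-polynomial ring `A[z;σ]`. An element is written with right
coefficients, `∑ z ^ j * a_j`, and is stored as the polynomial with `j`-th coefficient `a_j`.
Addition is the usual one; the multiplication is `SkewPoly.mul_eq_sum` below. -/
def SkewPoly (_σ : A ≃ₐ[F] A) : Type _ := A[X]

namespace SkewPoly

variable (σ : A ≃ₐ[F] A)

instance : AddCommGroup (SkewPoly σ) := inferInstanceAs (AddCommGroup A[X])

/-- The element of `A[z;σ]`, as the polynomial of its right coefficients. -/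
def toPoly : SkewPoly σ ≃+ A[X] := AddEquiv.refl _

variable {σ} in
/-- The coefficient of `z ^ j`, with coefficients written on the right. -/
def coeff (f : SkewPoly σ) (j : ℕ) : A := (toPoly σ f).coeff j

/-- The element `z ^ j * a`. -/
def monomial (j : ℕ) (a : A) : SkewPoly σ := (toPoly σ).symm (Polynomial.monomial j a)

/-- `(∑ z ^ j a_j) * (∑ z ^ l b_l) = ∑ z ^ (j + l) σ ^ l (a_j) b_l`. -/
instance : Mul (SkewPoly σ) where
  mul f g := (toPoly σ f).sum fun j a => (toPoly σ g).sum fun l b =>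
    monomial σ (j + l) ((σ ^ l) a * b)

instance : One (SkewPoly σ) := ⟨monomial σ 0 1⟩

theorem mul_eq_sum (f g : SkewPoly σ) :
    f * g = (toPoly σ f).sum fun j a => (toPoly σ g).sum fun l b =>
      monomial σ (j + l) ((σ ^ l) a * b) := rfl

theorem one_eq : (1 : SkewPoly σ) = monomial σ 0 1 := rfl

theorem monomial_zero (j : ℕ) : monomial σ j 0 = 0 := by
  simp [monomial]

theorem monomial_add (j : ℕ) (a b : A) :
    monomial σ j (a + b) = monomial σ j a + monomial σ j b := by
  simp [monomial]

theorem coeff_add (f g : SkewPoly σ) (j : ℕ) : (f + g).coeff j = f.coeff j + g.coeff j := by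
  simp [coeff]

theorem coeff_monomial (i j : ℕ) (a : A) :
    (monomial σ i a).coeff j = if i = j then a else 0 := by
  simp [coeff, monomial, Polynomial.coeff_monomial]

variable {σ} in
theorem ext {f g : SkewPoly σ} (h : ∀ j, f.coeff j = g.coeff j) : f = g :=
  (toPoly σ).injective (Polynomial.ext h)

variable {σ} in
theorem induction {P : SkewPoly σ → Prop} (f : SkewPoly σ)
    (hadd : ∀ f g, P f → P g → P (f + g)) (hmon : ∀ j a, P (monomial σ j a)) : P f := by
  rw [← (toPoly σ).symm_apply_apply f]
  induction toPoly σ f using Polynomial.induction_on' with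
  | add p q hp hq => rw [map_add]; exact hadd _ _ hp hq
  | monomial j a => exact hmon j a

theorem add_mul' (f g h : SkewPoly σ) : (f + g) * h = f * h + g * h := by
  rw [mul_eq_sum, mul_eq_sum, mul_eq_sum, map_add]
  refine Polynomial.sum_add_index _ _ _ ?_ ?_
  · intro j
    simp [monomial_zero, Polynomial.sum_def]
  · intro j a b
    simp [Polynomial.sum_def, add_mul, monomial_add, Finset.sum_add_distrib]

theorem mul_add' (f g h : SkewPoly σ) : f * (g + h) = f * g + f * h := by
  rw [mul_eq_sum, mul_eq_sum, mul_eq_sum, map_add]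
  rw [Polynomial.sum_def, Polynomial.sum_def, Polynomial.sum_def, ← Finset.sum_add_distrib]
  refine Finset.sum_congr rfl fun j _ => ?_
  refine Polynomial.sum_add_index _ _ _ ?_ ?_
  · intro l
    simp [monomial_zero]
  · intro l a b
    simp [mul_add, monomial_add]

theorem monomial_mul_monomial (j l : ℕ) (a b : A) :
    monomial σ j a * monomial σ l b = monomial σ (j + l) ((σ ^ l) a * b) := by
  have h : ∀ (i : ℕ) (c : A), toPoly σ (monomial σ i c) = Polynomial.monomial i c :=
    fun i c => (toPoly σ).apply_symm_apply _
  rw [mul_eq_sum, h, h, Polynomial.sum_monomial_index, Polynomial.sum_monomial_index]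
  · simp [monomial_zero]
  · simp [Polynomial.sum_def, monomial_zero]

theorem zero_mul' (f : SkewPoly σ) : 0 * f = 0 := by
  have h := add_mul' σ 0 0 f
  rw [add_zero] at h
  exact left_eq_add.mp h

theorem mul_zero' (f : SkewPoly σ) : f * 0 = 0 := by
  have h := mul_add' σ f 0 0
  rw [add_zero] at h
  exact left_eq_add.mp h

theorem one_mul' (f : SkewPoly σ) : 1 * f = f := by
  induction f using induction with
  | hadd f g hf hg => rw [mul_add', hf, hg]
  | hmon j a => rw [one_eq, monomial_mul_monomial]; simp

theorem mul_one' (f : SkewPoly σ) : f * 1 = f := by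
  induction f using induction with
  | hadd f g hf hg => rw [add_mul', hf, hg]
  | hmon j a => rw [one_eq, monomial_mul_monomial]; simp

theorem mul_assoc' (f g h : SkewPoly σ) : f * g * h = f * (g * h) := by
  induction f using induction with
  | hadd f f' hf hf' => rw [add_mul', add_mul', add_mul', hf, hf']
  | hmon i a =>
    induction g using induction with
    | hadd g g' hg hg' => rw [mul_add', add_mul', add_mul', mul_add', hg, hg']
    | hmon j b =>
      induction h using induction with
      | hadd h h' hh hh' => rw [mul_add', mul_add', mul_add', hh, hh']
      | hmon k c =>
        simp only [monomial_mul_monomial, map_mul]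
        rw [add_assoc, add_comm j k, pow_add, AlgEquiv.mul_apply, mul_assoc, add_comm k j]

instance : Ring (SkewPoly σ) :=
  { (inferInstance : AddCommGroup (SkewPoly σ)) with
    mul := (· * ·)
    one := 1
    left_distrib := mul_add' σ
    right_distrib := add_mul' σ
    zero_mul := zero_mul' σ
    mul_zero := mul_zero' σ
    mul_assoc := mul_assoc' σ
    one_mul := one_mul' σ
    mul_one := mul_one' σ }

/-- `A` as a subring of `A[z;σ]` (constant skew polynomials). -/
def C : A →+* SkewPoly σ where
  toFun := monomial σ 0
  map_one' := rfl
  map_mul' a b := by simp [monomial_mul_monomial]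
  map_zero' := monomial_zero σ 0
  map_add' := monomial_add σ 0

/-- The variable `z`. -/
def z : SkewPoly σ := monomial σ 1 1

theorem C_mul_z (a : A) : C σ a * z σ = z σ * C σ (σ a) := by
  simp [C, z, monomial_mul_monomial]

theorem monomial_eq (j : ℕ) (a : A) : monomial σ j a = z σ ^ j * C σ a := by
  have h : ∀ j, z σ ^ j = monomial σ j 1 := by
    intro j
    induction j with
    | zero => rfl
    | succ j ih => rw [pow_succ, ih, z, monomial_mul_monomial]; simp
  rw [h]
  simp [C, monomial_mul_monomial]

/-- `F[z]` as a subring of `A[z;σ]`: `∑ z ^ j c_j` with `c_j ∈ F` is mapped to itself, the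
coefficients being regarded as elements of `A`. -/
def ofPoly : F[X] →+* SkewPoly σ where
  toFun p := (toPoly σ).symm (p.map (algebraMap F A))
  map_one' := by simp [one_eq, monomial]
  map_zero' := by simp
  map_add' _ _ := by simp
  map_mul' p q := by
    induction p using Polynomial.induction_on' with
    | add p p' hp hp' => simp only [add_mul, Polynomial.map_add, map_add, hp, hp']
    | monomial i a =>
      induction q using Polynomial.induction_on' with
      | add q q' hq hq' => simp only [mul_add, Polynomial.map_add, map_add, hq, hq']
      | monomial j b =>
        have h := monomial_mul_monomial σ i j (algebraMap F A a) (algebraMap F A b)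
        rw [AlgEquiv.commutes, ← map_mul] at h
        unfold monomial at h
        simpa only [Polynomial.monomial_mul_monomial, Polynomial.map_monomial] using h.symm

theorem coeff_ofPoly (p : F[X]) (j : ℕ) : (ofPoly σ p).coeff j = algebraMap F A (p.coeff j) := by
  simp [ofPoly, coeff]

theorem coeff_mul_C (f : SkewPoly σ) (a : A) (j : ℕ) : (f * C σ a).coeff j = f.coeff j * a := by
  induction f using induction with
  | hadd f g hf hg => rw [add_mul, coeff_add, coeff_add, hf, hg, add_mul]
  | hmon i b =>
    change (monomial σ i b * monomial σ 0 a).coeff j = _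
    rw [monomial_mul_monomial, coeff_monomial, coeff_monomial]
    split_ifs <;> simp_all

/-- The left `F[z]`-module structure of `A[z;σ]`: multiplication from the left. -/
instance : Module F[X] (SkewPoly σ) := Module.compHom (SkewPoly σ) (ofPoly σ)

theorem smul_eq (p : F[X]) (f : SkewPoly σ) : p • f = ofPoly σ p * f := rfl

instance : IsScalarTower F[X] (SkewPoly σ) (SkewPoly σ) :=
  ⟨fun p f g => mul_assoc (ofPoly σ p) f g⟩

end SkewPoly

end SkewPoly

section CyclicAlgebra

variable (F : Type*) [Field F] (n : ℕ)

/-- `A = F[x] / (x ^ n - 1)`. -/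
abbrev CycAlg : Type _ := AdjoinRoot (X ^ n - 1 : F[X])

open Classical in
/-- The set of the monic irreducible factors `π_1, …, π_r` of `x ^ n - 1`. -/
def factors : Finset F[X] :=
  (UniqueFactorizationMonoid.normalizedFactors (X ^ n - 1 : F[X])).toFinset

instance : DecidableEq (factors F n) := Classical.decEq _

variable {F n}

theorem factors_dvd (k : factors F n) : (k : F[X]) ∣ X ^ n - 1 := by
  classical
  exact UniqueFactorizationMonoid.dvd_of_mem_normalizedFactors (Multiset.mem_toFinset.mp k.2)

theorem mem_factors (hn : 0 < n) (p : F[X]) :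
    p ∈ factors F n ↔ p.Monic ∧ Irreducible p ∧ p ∣ X ^ n - 1 := by
  classical
  have h0 : (X ^ n - 1 : F[X]) ≠ 0 := X_pow_sub_C_ne_zero hn 1
  rw [factors, Multiset.mem_toFinset, UniqueFactorizationMonoid.mem_normalizedFactors_iff' h0]
  constructor
  · rintro ⟨h1, h2, h3⟩
    exact ⟨(normalize_eq_self_iff_monic h1.ne_zero).mp h2, h1, h3⟩
  · rintro ⟨h1, h2, h3⟩
    exact ⟨h2, h1.normalize_eq_self, h3⟩

variable (F n) in
/-- The map `ψ : A → K_1 × ⋯ × K_r`, `K_k = F[x] / (π_k)`, with components the canonical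
projections `ρ_k`. -/
def crt : CycAlg F n →+* ((k : factors F n) → AdjoinRoot (k : F[X])) :=
  RingHom.pi fun k => (AdjoinRoot.algHomOfDvd F (X ^ n - 1) (k : F[X]) (factors_dvd k)).toRingHom

theorem crt_bijective [Fintype F] (hn : n.Coprime (Fintype.card F)) :
    Function.Bijective (crt F n) := by
  classical
  have hn0 : 0 < n := by
    rcases Nat.eq_zero_or_pos n with rfl | h
    · have := Fintype.one_lt_card (α := F)
      simp at hn
      omega
    · exact h
  have hf0 : (X ^ n - 1 : F[X]) ≠ 0 := X_pow_sub_C_ne_zero hn0 1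
  have hcast : (n : F) ≠ 0 := by
    intro h
    obtain ⟨p, hp⟩ := CharP.exists F
    have hpp : p.Prime := CharP.char_is_prime F p
    have h1 : p ∣ n := (CharP.cast_eq_zero_iff F p n).mp h
    have h2 : p ∣ Fintype.card F := (CharP.cast_eq_zero_iff F p _).mp (Nat.cast_card_eq_zero F)
    exact hpp.one_lt.ne' (Nat.dvd_one.mp (hn ▸ Nat.dvd_gcd h1 h2))
  have hsq : Squarefree (X ^ n - 1 : F[X]) := (X_pow_sub_one_separable_iff.mpr hcast).squarefree
  have hcop : Pairwise fun k l : factors F n => IsCoprime (k : F[X]) (l : F[X]) := by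
    intro k l hkl
    obtain ⟨hk1, hk2, -⟩ := (mem_factors hn0 _).mp k.2
    obtain ⟨hl1, hl2, -⟩ := (mem_factors hn0 _).mp l.2
    refine (hk2.coprime_iff_not_dvd).mpr fun h => hkl ?_
    exact Subtype.ext (eq_of_monic_of_associated hk1 hl1 (hk2.associated_of_dvd hl2 h))
  have hmk : ∀ (p : F[X]) (k : factors F n),
      crt F n (AdjoinRoot.mk _ p) k = AdjoinRoot.mk (k : F[X]) p := by
    intro p k
    change AdjoinRoot.algHomOfDvd F (X ^ n - 1) (k : F[X]) (factors_dvd k) (AdjoinRoot.mk _ p) = _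
    rw [AdjoinRoot.coe_algHomOfDvd]
    exact AdjoinRoot.aeval_eq p
  constructor
  · rw [injective_iff_map_eq_zero]
    intro a ha
    obtain ⟨p, rfl⟩ := AdjoinRoot.mk_surjective a
    have hdvd : ∀ k : factors F n, (k : F[X]) ∣ p := by
      intro k
      rw [← AdjoinRoot.mk_eq_zero, ← hmk, ha]
      rfl
    rw [AdjoinRoot.mk_eq_zero]
    have hprod : ∏ k : factors F n, (k : F[X]) ∣ p :=
      Fintype.prod_dvd_of_coprime hcop hdvd
    refine dvd_trans ?_ hprod
    have hnd := (UniqueFactorizationMonoid.squarefree_iff_nodup_normalizedFactors hf0).mp hsq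
    have h1 : ∏ k : factors F n, (k : F[X]) =
        (UniqueFactorizationMonoid.normalizedFactors (X ^ n - 1 : F[X])).prod := by
      rw [Finset.prod_coe_sort (factors F n) fun p => p]
      unfold factors
      rw [Finset.prod_eq_multiset_prod, Multiset.toFinset_val, hnd.dedup, Multiset.map_id']
    rw [h1]
    exact (UniqueFactorizationMonoid.prod_normalizedFactors hf0).symm.dvd
  · intro b
    have hs := Ideal.pi_quotient_surjective
      (I := fun k : factors F n => Ideal.span {(k : F[X])})
      (fun k l hkl => (Ideal.isCoprime_span_singleton_iff _ _).mpr (hcop hkl)) b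
    obtain ⟨p, hp⟩ := hs
    refine ⟨AdjoinRoot.mk _ p, funext fun k => ?_⟩
    rw [hmk]
    exact hp k

/-- The primitive idempotent `ε_k = ψ⁻¹(0, …, 0, 1, 0, …, 0)` of `A`. -/
def idem [Fintype F] (hn : n.Coprime (Fintype.card F)) (k : factors F n) : CycAlg F n :=
  (RingEquiv.ofBijective (crt F n) (crt_bijective hn)).symm (Pi.single k 1)

variable {σ : CycAlg F n ≃ₐ[F] CycAlg F n}

/-- The `k`-th component `f^{(k)} = ε_k f` of `f`. -/
def component [Fintype F] (hn : n.Coprime (Fintype.card F)) (f : SkewPoly σ)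
    (k : factors F n) : SkewPoly σ :=
  SkewPoly.C σ (idem hn k) * f

open Classical in
/-- The support `T_f = {k | f^{(k)} ≠ 0}` of `f`. -/
def support [Fintype F] (hn : n.Coprime (Fintype.card F)) (f : SkewPoly σ) :
    Finset (factors F n) :=
  Finset.univ.filter fun k => component hn f k ≠ 0

variable (σ)

/-- The map `𝔭 : F[z] ^ n → A[z;σ]`,
`𝔭 (∑ z ^ j v_j) = ∑ z ^ j 𝔭 (v_j)` with `𝔭 (v_j) = ∑ v_{j,i} x ^ i`; see `coeff_toSkew`. -/
def toSkew : (Fin n → F[X]) →ₗ[F[X]] SkewPoly σ :=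
  Fintype.linearCombination F[X]
    fun i : Fin n => SkewPoly.C σ (AdjoinRoot.root (X ^ n - 1 : F[X]) ^ (i : ℕ))

theorem coeff_toSkew (v : Fin n → F[X]) (j : ℕ) :
    (toSkew σ v).coeff j =
      ∑ i : Fin n, (v i).coeff j • AdjoinRoot.root (X ^ n - 1 : F[X]) ^ (i : ℕ) := by
  have hsum : ∀ (s : Finset (Fin n)) (f : Fin n → SkewPoly σ),
      (∑ i ∈ s, f i).coeff j = ∑ i ∈ s, (f i).coeff j := fun s f =>
    map_sum (AddMonoidHom.mk' (fun g : SkewPoly σ => g.coeff j)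
      fun a b => SkewPoly.coeff_add σ a b j) f s
  rw [toSkew, Fintype.linearCombination_apply, hsum]
  refine Finset.sum_congr rfl fun i _ => ?_
  rw [SkewPoly.smul_eq, SkewPoly.coeff_mul_C, SkewPoly.coeff_ofPoly, Algebra.smul_def]

/-- A submodule `S` of `F[z] ^ n` is `σ`-cyclic if `𝔭 (S)` is a left ideal of `A[z;σ]`. -/
def IsSigmaCyclic (S : Submodule F[X] (Fin n → F[X])) : Prop :=
  ∃ I : Ideal (SkewPoly σ), (I : Set (SkewPoly σ)) = toSkew σ '' (S : Set (Fin n → F[X]))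

/-- A `σ`-cyclic convolutional code: a direct summand of `F[z] ^ n` that is `σ`-cyclic. -/
def IsSigmaCyclicCode (S : Submodule F[X] (Fin n → F[X])) : Prop :=
  IsComplemented S ∧ IsSigmaCyclic σ S

end CyclicAlgebra

end Piret

end

/-! By the Chinese remainder theorem `A` is a finite product of fields `A e_k`, and all arguments
about `R = A[z;σ]` use only such a system of idempotents. Leading coefficients in `R e_k` lie in the
field `A e_k`, so `R e_k` admits division with remainder and its nonzero left subideals are
principal, of the form `R w` with `w = e_l w`; moreover `R w ≅ R e_l`. Projecting onto one `R e_k`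
at a time and splitting shows that every left ideal of `R` is a finite direct sum of copies of the
projective modules `R e_l` (`IsFieldSystem.exists_isIdemBasis`): `R` is left hereditary.

A direct summand `I` over `F[z]` is saturated. Choose a left ideal `J` with `I ∩ J = 0` for which `I
⊕ J` contains a nonzero central polynomial `p = a + b`, `a ∈ I`, `b ∈ J`. Centrality and saturation
make `I` the kernel of right multiplication by `b`, so `R / I ≅ R b` is a left ideal, hence
projective, and `I` splits off over `R` (`IsFieldSystem.isComplemented_of_saturated`).

If `R = I ⊕ J`, the decompositions of `I` and `J` together decompose `R`. Reducing modulo `z` gives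
a decomposition of `A`, in which each `A e_k` has multiplicity one; so the generators are `e_k u`
for a single unit `u`, and `I` is generated by the sum of some of them. -/

namespace Piret

namespace SkewPoly

variable {F A : Type*} [Field F] [CommRing A] [Algebra F A] {σ : A ≃ₐ[F] A}

/-! ### Coefficients and leading terms -/

theorem coeff_zero (j : ℕ) : (0 : SkewPoly σ).coeff j = 0 := by simp [coeff]

theorem coeff_sub (f g : SkewPoly σ) (j : ℕ) : (f - g).coeff j = f.coeff j - g.coeff j := by
  simp [coeff]

theorem coeff_mul (f g : SkewPoly σ) (m : ℕ) :
    (f * g).coeff m =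
      ∑ p ∈ Finset.HasAntidiagonal.antidiagonal m, (σ ^ p.2) (f.coeff p.1) * g.coeff p.2 := by
  induction f using induction with
  | hadd f f' hf hf' =>
    simp only [add_mul, coeff_add, hf, hf', map_add, Finset.sum_add_distrib]
  | hmon i a =>
    induction g using induction with
    | hadd g g' hg hg' =>
      simp only [mul_add, coeff_add, hg, hg', Finset.sum_add_distrib]
    | hmon j b =>
      rw [monomial_mul_monomial]
      simp only [coeff_monomial]
      by_cases h : i + j = m
      · rw [if_pos h, Finset.sum_eq_single (i, j)]
        · simp
        · rintro ⟨x, y⟩ - hne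
          by_cases hx : i = x
          · by_cases hy : j = y
            · exact absurd (by rw [hx, hy]) hne
            · simp [hy]
          · simp [hx]
        · intro hn
          exact absurd (Finset.HasAntidiagonal.mem_antidiagonal.mpr h) hn
      · rw [if_neg h, Finset.sum_eq_zero]
        rintro ⟨x, y⟩ hxy
        have hxy' : x + y = m := Finset.HasAntidiagonal.mem_antidiagonal.mp hxy
        by_cases hx : i = x
        · have hy : j ≠ y := by omega
          simp [hy]
        · simp [hx]

theorem coeff_C_mul (a : A) (f : SkewPoly σ) (j : ℕ) :
    (C σ a * f).coeff j = (σ ^ j) a * f.coeff j := by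
  rw [coeff_mul, Finset.sum_eq_single (0, j)]
  · simp [C, coeff_monomial]
  · rintro ⟨x, y⟩ hxy hne
    have hxy' : x + y = j := Finset.HasAntidiagonal.mem_antidiagonal.mp hxy
    have hx : 0 ≠ x := by
      rintro rfl
      exact hne (by rw [← hxy', zero_add])
    simp [C, coeff_monomial, hx]
  · simp

theorem mul_coeff_zero (f g : SkewPoly σ) : (f * g).coeff 0 = f.coeff 0 * g.coeff 0 := by
  simp [coeff_mul]

theorem exists_eq_z_mul {f : SkewPoly σ} (hf : f.coeff 0 = 0) : ∃ g, f = z σ * g := by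
  have key : ∀ f : SkewPoly σ, ∃ g, f = C σ (f.coeff 0) + z σ * g := by
    intro f
    induction f using induction with
    | hadd f f' hf hf' =>
      obtain ⟨g, hg⟩ := hf
      obtain ⟨g', hg'⟩ := hf'
      refine ⟨g + g', ?_⟩
      rw [coeff_add, map_add, mul_add]
      nth_rewrite 1 [hg, hg']
      abel
    | hmon j a =>
      cases j with
      | zero => exact ⟨0, by simp [C, coeff_monomial]⟩
      | succ j =>
        refine ⟨monomial σ j a, ?_⟩
        rw [z, monomial_mul_monomial, coeff_monomial]
        simp [add_comm]
  obtain ⟨g, hg⟩ := key f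
  exact ⟨g, by rw [hg, hf, map_zero, zero_add]⟩

/-- The degree of a nonzero skew polynomial, characterized by its leading coefficient. -/
theorem exists_leading {f : SkewPoly σ} (hf : f ≠ 0) :
    ∃ d, f.coeff d ≠ 0 ∧ ∀ j, d < j → f.coeff j = 0 := by
  have h0 : toPoly σ f ≠ 0 := by simpa using hf
  exact ⟨(toPoly σ f).natDegree, by simpa [coeff] using h0,
    fun j hj => coeff_eq_zero_of_natDegree_lt hj⟩

theorem exists_bound (f : SkewPoly σ) : ∃ d, ∀ j, d ≤ j → f.coeff j = 0 :=
  ⟨(toPoly σ f).natDegree + 1, fun _ hj => coeff_eq_zero_of_natDegree_lt hj⟩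

theorem coeff_mul_leading {f g : SkewPoly σ} {d e : ℕ} (hf : ∀ j, d < j → f.coeff j = 0)
    (hg : ∀ j, e < j → g.coeff j = 0) :
    (f * g).coeff (d + e) = (σ ^ e) (f.coeff d) * g.coeff e := by
  rw [coeff_mul, Finset.sum_eq_single (d, e)]
  · rintro ⟨x, y⟩ hxy hne
    have hxy' : x + y = d + e := Finset.HasAntidiagonal.mem_antidiagonal.mp hxy
    rcases lt_trichotomy d x with h | h | h
    · simp [hf x h]
    · exact absurd (by rw [h, show y = e by omega]) hne
    · simp [hg y (by omega)]
  · simp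

theorem coeff_mul_eq_zero {f g : SkewPoly σ} {d e : ℕ} (hf : ∀ j, d < j → f.coeff j = 0)
    (hg : ∀ j, e < j → g.coeff j = 0) {m : ℕ} (hm : d + e < m) : (f * g).coeff m = 0 := by
  rw [coeff_mul, Finset.sum_eq_zero]
  rintro ⟨x, y⟩ hxy
  have hxy' : x + y = m := Finset.HasAntidiagonal.mem_antidiagonal.mp hxy
  by_cases h : d < x
  · simp [hf x h]
  · simp [hg y (by omega)]

/-! ### Left ideals as direct sums of modules `A[z;σ] e_l` -/

section Hereditary

variable {F A ι : Type*} [Field F] [CommRing A] [Algebra F A] [Fintype ι]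

/-- A complete system of orthogonal idempotents `e k` for which every `A e_k` is a field. -/
structure IsFieldSystem (e : ι → A) : Prop extends CompleteOrthogonalIdempotents e where
  ne_zero : ∀ k, e k ≠ 0
  exists_mul_eq : ∀ k a, a * e k ≠ 0 → ∃ b, a * b = e k

variable {σ : A ≃ₐ[F] A} {e : ι → A} (he : IsFieldSystem e)
include he

theorem IsFieldSystem.sum_C : ∑ k, C σ (e k) = 1 := by
  rw [← map_sum, he.complete, map_one]

theorem IsFieldSystem.C_mul_self (k : ι) : C σ (e k) * C σ (e k) = C σ (e k) := by
  rw [← map_mul, (he.idem k).eq]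

theorem IsFieldSystem.C_mul_of_ne {k l : ι} (h : k ≠ l) : C σ (e k) * C σ (e l) = 0 := by
  rw [← map_mul, he.ortho h, map_zero]

theorem IsFieldSystem.sum_mul (f : SkewPoly σ) : ∑ k, C σ (e k) * f = f := by
  rw [← Finset.sum_mul, he.sum_C, one_mul]

theorem IsFieldSystem.mul_sum (f : SkewPoly σ) : ∑ k, f * C σ (e k) = f := by
  rw [← Finset.mul_sum, he.sum_C, mul_one]

/-- Compare leading coefficients: that of `r e_l` is a unit of the field `A e_l`, so its image under
a power of `σ` cannot kill the leading coefficient of `w = e_l w`. Hence right multiplication by `w`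
embeds `A[z;σ] e_l`. -/
theorem IsFieldSystem.mul_C_eq_zero {l : ι} {w r : SkewPoly σ} (hw : w ≠ 0)
    (hlw : C σ (e l) * w = w) (hr : r * w = 0) : r * C σ (e l) = 0 := by
  by_contra hs
  obtain ⟨d, hd, hd'⟩ := exists_leading hs
  obtain ⟨c, hc, hc'⟩ := exists_leading hw
  have h0 : (r * C σ (e l) * w).coeff (d + c) = 0 := by
    rw [mul_assoc, hlw, hr, coeff_zero]
  rw [coeff_mul_leading hd' hc', coeff_mul_C] at h0
  rw [coeff_mul_C] at hd
  obtain ⟨b, hb⟩ := he.exists_mul_eq l _ hd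
  have h1 : (σ ^ c) (e l) * w.coeff c = w.coeff c := by rw [← coeff_C_mul, hlw]
  apply hc
  rw [← h1, ← (he.idem l).eq]
  nth_rewrite 1 [← hb]
  rw [map_mul, map_mul]
  rw [map_mul] at h0
  linear_combination (σ ^ c) b * h0

/-- Division with remainder works inside `A[z;σ] e_k` because the leading coefficient of `f` is
invertible in the field `A e_k`. -/
theorem IsFieldSystem.exists_quotient {k : ι} {f : SkewPoly σ} {d : ℕ}
    (hfk : f * C σ (e k) = f) (hd : f.coeff d ≠ 0) (hd' : ∀ j, d < j → f.coeff j = 0)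
    (h : SkewPoly σ) (hk : h * C σ (e k) = h) :
    ∃ q, ∀ j, d ≤ j → (h - q * f).coeff j = 0 := by
  obtain ⟨m, hm⟩ := exists_bound h
  induction m generalizing h with
  | zero => exact ⟨0, fun j _ => by rw [zero_mul, sub_zero, hm j (Nat.zero_le j)]⟩
  | succ m ih =>
    by_cases hmd : m < d
    · exact ⟨0, fun j hj => by rw [zero_mul, sub_zero, hm j (by omega)]⟩
    · have h1 : f.coeff d * e k = f.coeff d := by rw [← coeff_mul_C, hfk]
      obtain ⟨b, hb⟩ := he.exists_mul_eq k (f.coeff d) (by rwa [h1])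
      -- Moving the coefficient of `q` past `z ^ d` applies `σ ^ d`; the inverse twist compensates,
      -- so that `q * f` has the same coefficient as `h` in degree `m`.
      set q := monomial σ (m - d) ((σ ^ d).symm (h.coeff m * b)) with hq
      have hqb : ∀ j, m - d < j → q.coeff j = 0 := fun j hj => by
        rw [hq, coeff_monomial, if_neg (by omega)]
      obtain ⟨q', hq'⟩ := ih (h - q * f) (by rw [sub_mul, mul_assoc, hfk, hk]) (by
        intro j hj
        rw [coeff_sub]
        rcases hj.eq_or_lt with rfl | hj
        · have h2 := coeff_mul_leading hqb hd'
          rw [Nat.sub_add_cancel (by omega)] at h2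
          rw [h2, hq, coeff_monomial, if_pos rfl, AlgEquiv.apply_symm_apply]
          have h3 : h.coeff m * e k = h.coeff m := by rw [← coeff_mul_C, hk]
          rw [← h3, ← hb]
          rw [← hb] at h3
          linear_combination (-b * f.coeff d) * h3
        · rw [hm j hj, coeff_mul_eq_zero hqb hd' (by omega), sub_zero])
      refine ⟨q + q', fun j hj => ?_⟩
      rw [add_mul, ← sub_sub, hq' j hj]

/-- Nonzero left ideals inside `A[z;σ] e_k` are principal. -/
theorem IsFieldSystem.exists_generator {k : ι} (N : Ideal (SkewPoly σ))
    (hN : ∀ x ∈ N, x * C σ (e k) = x) (h0 : ∃ x ∈ N, x ≠ 0) :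
    ∃ w ∈ N, ∃ l, w ≠ 0 ∧ C σ (e l) * w = w ∧ ∀ x ∈ N, ∃ q, x = q * w := by
  classical
  have hex : ∃ d, ∃ x ∈ N, x.coeff d ≠ 0 ∧ ∀ j, d < j → x.coeff j = 0 := by
    obtain ⟨x, hx, hx0⟩ := h0
    obtain ⟨d, hd⟩ := exists_leading hx0
    exact ⟨d, x, hx, hd⟩
  obtain ⟨x, hx, hxd, hxd'⟩ := Nat.find_spec hex
  set d := Nat.find hex with hdef
  have hmin : ∀ y ∈ N, (∀ j, d ≤ j → y.coeff j = 0) → y = 0 := by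
    intro y hy hyd
    by_contra hy0
    obtain ⟨c, hc, hc'⟩ := exists_leading hy0
    have hcd : c < d := by
      by_contra h
      exact hc (hyd c (not_lt.mp h))
    exact Nat.find_min hex hcd ⟨y, hy, hc, hc'⟩
  -- The `σ ^ d (e l)` sum to `1`, so some `e l` does not kill the leading coefficient of `x`; then
  -- `e l * x` still has the minimal degree `d`.
  have hl : ∃ l, (C σ (e l) * x).coeff d ≠ 0 := by
    by_contra! hl
    apply hxd
    have h2 : ∑ l, (C σ (e l) * x).coeff d = x.coeff d := by
      simp_rw [coeff_C_mul, ← Finset.sum_mul, ← map_sum]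
      rw [he.complete, map_one, one_mul]
    rw [← h2, Finset.sum_eq_zero fun l _ => hl l]
  obtain ⟨l, hl⟩ := hl
  have hwN : C σ (e l) * x ∈ N := N.mul_mem_left _ hx
  refine ⟨C σ (e l) * x, hwN, l, ?_, ?_, ?_⟩
  · intro h
    rw [h, coeff_zero] at hl
    exact hl rfl
  · rw [← mul_assoc, he.C_mul_self]
  · intro y hy
    obtain ⟨q, hq⟩ := he.exists_quotient (hN _ hwN) hl
      (fun j hj => by rw [coeff_C_mul, hxd' j hj, mul_zero]) y (hN y hy)
    exact ⟨q, sub_eq_zero.mp (hmin _ (N.sub_mem hy (N.mul_mem_left _ hwN)) hq)⟩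

omit he in
/-- `N` is the direct sum of the `A[z;σ] f i`, with `f i ∈ e_(l i) A[z;σ]` and
`A[z;σ] e_(l i) ≅ A[z;σ] f i` by right multiplication. -/
structure IsIdemBasis (e : ι → A) (N : Ideal (SkewPoly σ)) {κ : Type*} [Fintype κ] (l : κ → ι)
    (f : κ → SkewPoly σ) : Prop where
  C_mul : ∀ i, C σ (e (l i)) * f i = f i
  mem_iff : ∀ x, x ∈ N ↔ ∃ r : κ → SkewPoly σ, x = ∑ i, r i * f i
  indep : ∀ r : κ → SkewPoly σ, ∑ i, r i * f i = 0 → ∀ i, r i * C σ (e (l i)) = 0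

/-- Right multiplication by `e k` maps `N` onto zero or a principal ideal isomorphic to some `A[z;σ]
e_j`. The latter is projective, so `N` is the direct sum of a lift of the image and the kernel, and
the kernel is supported on the smaller set. -/
theorem IsFieldSystem.exists_isIdemBasis_of_support (S : Finset ι) (N : Ideal (SkewPoly σ))
    (hN : ∀ x ∈ N, ∀ k ∉ S, x * C σ (e k) = 0) :
    ∃ (κ : Type) (_ : Fintype κ) (l : κ → ι) (f : κ → SkewPoly σ), IsIdemBasis e N l f := by
  classical
  induction S using Finset.induction_on generalizing N with
  | empty =>
    refine ⟨Empty, inferInstance, Empty.elim, Empty.elim, fun i => i.elim, fun x => ?_,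
      fun r _ i => i.elim⟩
    have h1 : x ∈ N → x = 0 := fun hx => by
      rw [← he.mul_sum x]
      exact Finset.sum_eq_zero fun k _ => hN x hx k (by simp)
    simp only [Finset.univ_eq_empty, Finset.sum_empty]
    exact ⟨fun hx => ⟨0, h1 hx⟩, fun ⟨_, hx⟩ => hx ▸ N.zero_mem⟩
  | insert k S hkS ih =>
    by_cases hk : ∀ x ∈ N, x * C σ (e k) = 0
    · refine ih N fun x hx j hj => ?_
      by_cases hjk : j = k
      · rw [hjk]
        exact hk x hx
      · exact hN x hx j (by simp [hjk, hj])
    push Not at hk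
    set ρ : SkewPoly σ →ₗ[SkewPoly σ] SkewPoly σ :=
      LinearMap.toSpanSingleton _ _ (C σ (e k)) with hρ
    have hρ' : ∀ x, ρ x = x * C σ (e k) := fun x => rfl
    obtain ⟨w, hw, j, hw0, hjw, hgen⟩ := he.exists_generator (k := k) (Submodule.map ρ N) (by
        rintro _ ⟨x, -, rfl⟩
        rw [hρ', mul_assoc, he.C_mul_self]) (by
        obtain ⟨x, hx, hx0⟩ := hk
        exact ⟨_, ⟨x, hx, rfl⟩, hx0⟩)
    obtain ⟨y, hy, rfl⟩ := hw
    rw [hρ'] at *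
    obtain ⟨κ, _, l, f, hf⟩ := ih (N ⊓ LinearMap.ker ρ) (by
      rintro x ⟨hx, hx'⟩ i hi
      by_cases hik : i = k
      · rw [hik]
        exact hx'
      · exact hN x hx i (by simp [hik, hi]))
    -- The lift of the generator `y e_k` is taken in `e_j A[z;σ]`; this gives the splitting.
    set h := C σ (e j) * y with hh
    have hhk : h * C σ (e k) = y * C σ (e k) := by rw [hh, mul_assoc, hjw]
    have hhN : h ∈ N := N.mul_mem_left _ hy
    refine ⟨Option κ, inferInstance, fun i => i.elim j l, fun i => i.elim h f, ?_, ?_, ?_⟩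
    · rintro (_ | i)
      · change C σ (e j) * h = h
        rw [hh, ← mul_assoc, he.C_mul_self]
      · exact hf.C_mul i
    · intro x
      simp only [Fintype.sum_option, Option.elim]
      constructor
      · intro hx
        obtain ⟨q, hq⟩ := hgen _ ⟨x, hx, rfl⟩
        obtain ⟨r, hr⟩ := (hf.mem_iff (x - q * h)).mp
          ⟨N.sub_mem hx (N.mul_mem_left _ hhN), by
            change ρ _ = 0
            rw [hρ', sub_mul, mul_assoc, hhk, ← hq, hρ', sub_self]⟩
        refine ⟨fun i => i.elim q r, ?_⟩
        simp only [Option.elim, ← hr]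
        abel
      · rintro ⟨r, rfl⟩
        exact N.add_mem (N.mul_mem_left _ hhN) ((hf.mem_iff _).mpr ⟨fun i => r (some i), rfl⟩).1
    · intro r hr
      simp only [Fintype.sum_option, Option.elim] at hr
      have hker : ρ (∑ i, r (some i) * f i) = 0 :=
        ((hf.mem_iff _).mpr ⟨fun i => r (some i), rfl⟩).2
      have h1 : r none * (y * C σ (e k)) = 0 := by
        have h2 := congrArg ρ hr
        rw [map_add, hker, add_zero, map_zero, hρ', mul_assoc, hhk] at h2
        exact h2
      have h2 := he.mul_C_eq_zero hw0 hjw h1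
      have h3 : r none * h = 0 := by rw [hh, ← mul_assoc, h2, zero_mul]
      rw [h3, zero_add] at hr
      rintro (_ | i)
      · exact h2
      · exact hf.indep _ hr i

theorem IsFieldSystem.exists_isIdemBasis (N : Ideal (SkewPoly σ)) :
    ∃ (κ : Type) (_ : Fintype κ) (l : κ → ι) (f : κ → SkewPoly σ), IsIdemBasis e N l f :=
  he.exists_isIdemBasis_of_support Finset.univ N fun _ _ k hk => absurd (Finset.mem_univ k) hk

end Hereditary

/-! ### Torsion, central polynomials and complements -/

section Ideals

variable {F A ι : Type*} [Field F] [CommRing A] [Algebra F A] {σ : A ≃ₐ[F] A}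

theorem coeff_sum {κ : Type*} (s : Finset κ) (f : κ → SkewPoly σ) (j : ℕ) :
    (∑ i ∈ s, f i).coeff j = ∑ i ∈ s, (f i).coeff j :=
  map_sum (AddMonoidHom.mk' (fun g : SkewPoly σ => g.coeff j) fun a b => coeff_add σ a b j) f s

theorem coeff_C_zero (a : A) : (C σ a).coeff 0 = a := by simp [C, coeff_monomial]

/-- The leading coefficient of `p` is a nonzero scalar, which `σ` fixes and which kills no nonzero
element of `A`. -/
theorem eq_zero_of_ofPoly_mul {p : F[X]} (hp : p ≠ 0) {f : SkewPoly σ}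
    (hf : ofPoly σ p * f = 0) : f = 0 := by
  by_contra h0
  obtain ⟨d, hd, hd'⟩ := exists_leading h0
  have h1 : (ofPoly σ p * f).coeff (p.natDegree + d) = 0 := by rw [hf, coeff_zero]
  rw [coeff_mul_leading (fun j hj => by
    rw [coeff_ofPoly, coeff_eq_zero_of_natDegree_lt hj, map_zero]) hd', coeff_ofPoly,
    AlgEquiv.commutes, ← Algebra.smul_def] at h1
  refine hd ?_
  exact (smul_eq_zero_iff_right (leadingCoeff_ne_zero.mpr hp)).mp h1

variable (σ) in
/-- The polynomials in `F[z]` that are central in `A[z;σ]`. -/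
noncomputable def centralPolys : Subring F[X] := (Subring.center (SkewPoly σ)).comap (ofPoly σ)

theorem comm_of_mem_centralPolys {p : F[X]} (hp : p ∈ centralPolys σ) (f : SkewPoly σ) :
    f * ofPoly σ p = ofPoly σ p * f :=
  Subring.mem_center_iff.mp hp f

theorem ofPoly_X_pow (j : ℕ) : ofPoly σ (X ^ j) = monomial σ j 1 := by
  refine ext fun i => ?_
  rw [coeff_ofPoly, coeff_monomial, coeff_X_pow]
  simp [eq_comm]

theorem X_pow_mem_centralPolys {m : ℕ} (hm : σ ^ m = 1) (i : ℕ) :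
    (X ^ (m * i) : F[X]) ∈ centralPolys σ := by
  refine Subring.mem_center_iff.mpr fun f => ?_
  rw [ofPoly_X_pow]
  induction f using induction with
  | hadd f g hf hg => rw [add_mul, mul_add, hf, hg]
  | hmon j a =>
    rw [monomial_mul_monomial, monomial_mul_monomial, pow_mul, hm, one_pow, add_comm]
    simp

/-- Saturation: the quotient by a summand embeds in the torsion-free module `A[z;σ]`. -/
theorem mem_of_ofPoly_mul_mem {I : Ideal (SkewPoly σ)}
    (hI : IsComplemented (I.restrictScalars F[X])) {p : F[X]} (hp : p ≠ 0) {f : SkewPoly σ}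
    (hf : ofPoly σ p * f ∈ I) : f ∈ I := by
  obtain ⟨N, hN⟩ := hI
  have hfT : f ∈ I.restrictScalars F[X] ⊔ N := by rw [hN.sup_eq_top]; trivial
  obtain ⟨a, ha, b, hb, rfl⟩ := Submodule.mem_sup.mp hfT
  have hb' : p • b ∈ I.restrictScalars F[X] := by
    have h : p • b = ofPoly σ p * (a + b) - ofPoly σ p * a := by rw [smul_eq, mul_add]; abel
    rw [h]
    exact I.sub_mem hf (I.mul_mem_left _ ha)
  have h0 := Submodule.disjoint_def.mp hN.disjoint _ hb' (N.smul_mem p hb)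
  rw [eq_zero_of_ofPoly_mul hp h0, add_zero]
  exact ha

theorem isCompl_restrictScalars {I J : Ideal (SkewPoly σ)} (h : IsCompl I J) :
    IsCompl (I.restrictScalars F[X]) (J.restrictScalars F[X]) := by
  refine ⟨Submodule.disjoint_def.mpr fun x hx hx' =>
    Submodule.disjoint_def.mp h.disjoint x hx hx', codisjoint_iff.mpr (eq_top_iff.mpr ?_)⟩
  intro x _
  have hx : x ∈ I ⊔ J := by rw [h.sup_eq_top]; trivial
  obtain ⟨a, ha, b, hb, rfl⟩ := Submodule.mem_sup.mp hx
  exact Submodule.mem_sup.mpr ⟨a, ha, b, hb, rfl⟩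

variable [Fintype ι] {e : ι → A}

/-- Remainders modulo `f` in `A[z;σ] e_k` have bounded degree over a finite ring, so two of the
central powers `z ^ (m i)`, with `m` the order of `σ`, agree modulo `f` after multiplication by `e
k`. Their difference is the required polynomial. -/
theorem IsFieldSystem.exists_central_mul [Finite A] (he : IsFieldSystem e) {k : ι}
    {f : SkewPoly σ} (hf : f ≠ 0) (hfk : f * C σ (e k) = f) :
    ∃ p ∈ centralPolys σ, p ≠ 0 ∧ ∃ q, ofPoly σ p * C σ (e k) = q * f := by
  obtain ⟨d, hd, hd'⟩ := exists_leading hf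
  have hfin : Finite (A ≃ₐ[F] A) :=
    Finite.of_injective (fun τ : A ≃ₐ[F] A => (τ : A → A)) DFunLike.coe_injective
  set m := orderOf σ with hm
  have hm0 : 0 < m := orderOf_pos σ
  have hz : ∀ i, ∃ q : SkewPoly σ, ∀ j, d ≤ j →
      (ofPoly σ (X ^ (m * i)) * C σ (e k) - q * f).coeff j = 0 := fun i =>
    he.exists_quotient hfk hd hd' _ (by rw [mul_assoc, he.C_mul_self])
  choose q hq using hz
  obtain ⟨i, j, hij, heq⟩ := Finite.exists_ne_map_eq_of_infinite fun i : ℕ => fun c : Fin d =>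
    (ofPoly σ (X ^ (m * i)) * C σ (e k) - q i * f).coeff c
  refine ⟨X ^ (m * i) - X ^ (m * j), (centralPolys σ).sub_mem
    (X_pow_mem_centralPolys (pow_orderOf_eq_one σ) i)
    (X_pow_mem_centralPolys (pow_orderOf_eq_one σ) j), ?_, q i - q j, ?_⟩
  · rw [sub_ne_zero]
    intro h
    have h1 := congrArg natDegree h
    rw [natDegree_X_pow, natDegree_X_pow] at h1
    exact hij (Nat.eq_of_mul_eq_mul_left hm0 h1)
  · have h1 : ofPoly σ (X ^ (m * i)) * C σ (e k) - q i * f =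
        ofPoly σ (X ^ (m * j)) * C σ (e k) - q j * f := by
      refine ext fun c => ?_
      by_cases hc : c < d
      · exact congrFun heq ⟨c, hc⟩
      · rw [hq i c (not_lt.mp hc), hq j c (not_lt.mp hc)]
    rw [map_sub, sub_mul, sub_mul, ← sub_eq_zero]
    rw [← sub_eq_zero] at h1
    rw [← h1]
    abel

variable (σ e) in
/-- The left ideal of the elements of `A[z;σ]` that are fixed by `∑ k ∈ S, e k` from the
right. -/
def rightSupported (S : Finset ι) : Ideal (SkewPoly σ) where
  carrier := {x | ∀ k ∉ S, x * C σ (e k) = 0}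
  add_mem' ha hb k hk := by rw [add_mul, ha k hk, hb k hk, add_zero]
  zero_mem' k _ := zero_mul _
  smul_mem' c x hx k hk := by rw [smul_eq_mul, mul_assoc, hx k hk, mul_zero]

/-- Take for `J` a sum of modules `A[z;σ] e_k` that is maximal subject to meeting `I` trivially. By
maximality `I ⊕ J` meets every `A[z;σ] e_k`, so it contains a nonzero central multiple of each `e
k`, and the product of these multipliers lies in it. -/
theorem IsFieldSystem.exists_disjoint_of_forall [Finite A] (he : IsFieldSystem e)
    (I : Ideal (SkewPoly σ)) :
    ∃ J : Ideal (SkewPoly σ), Disjoint I J ∧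
      ∃ p ∈ centralPolys σ, p ≠ 0 ∧ ofPoly σ p ∈ I ⊔ J := by
  classical
  obtain ⟨S, hS⟩ := (Set.toFinite {S : Finset ι | Disjoint I (rightSupported σ e S)}).exists_maximal
    ⟨∅, Submodule.disjoint_def.mpr fun x _ hx => by
      rw [← he.mul_sum x]
      exact Finset.sum_eq_zero fun k _ => hx k (by simp)⟩
  have hne : ∀ k, ∃ f ∈ I ⊔ rightSupported σ e S, f ≠ 0 ∧ f * C σ (e k) = f := by
    intro k
    by_cases hk : k ∈ S
    · refine ⟨C σ (e k), Submodule.mem_sup_right fun j hj => he.C_mul_of_ne ?_, ?_,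
        he.C_mul_self k⟩
      · rintro rfl
        exact hj hk
      · intro h
        refine he.ne_zero k ?_
        rw [← coeff_C_zero (σ := σ) (e k), h, coeff_zero]
    · have hnot : ¬ Disjoint I (rightSupported σ e (insert k S)) := fun h =>
        hk (hS.2 h (Finset.subset_insert k S) (Finset.mem_insert_self k S))
      rw [Submodule.disjoint_def] at hnot
      push Not at hnot
      obtain ⟨x, hxI, hxS, hx0⟩ := hnot
      -- The component of `x` at `k` differs from `x ∈ I` by an element supported on `S`. It is
      -- nonzero, since otherwise `x` itself would be supported on `S`.
      refine ⟨x * C σ (e k), ?_, ?_, by rw [mul_assoc, he.C_mul_self]⟩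
      · have h : x * C σ (e k) = x + (x * C σ (e k) - x) := by abel
        rw [h]
        refine Submodule.add_mem_sup hxI fun j hj => ?_
        by_cases hjk : j = k
        · rw [hjk, sub_mul, mul_assoc, he.C_mul_self, sub_self]
        · rw [sub_mul, mul_assoc, he.C_mul_of_ne (Ne.symm hjk), mul_zero,
            hxS j (by simp [hjk, hj]), sub_zero]
      · intro h
        refine hx0 (Submodule.disjoint_def.mp hS.1 x hxI fun j hj => ?_)
        by_cases hjk : j = k
        · rw [hjk, h]
        · exact hxS j (by simp [hjk, hj])
  have hcen : ∀ k, ∃ p ∈ centralPolys σ, p ≠ 0 ∧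
      ofPoly σ p * C σ (e k) ∈ I ⊔ rightSupported σ e S := by
    intro k
    obtain ⟨f, hf, hf0, hfk⟩ := hne k
    obtain ⟨p, hp, hp0, q, hq⟩ := he.exists_central_mul hf0 hfk
    exact ⟨p, hp, hp0, hq ▸ Ideal.mul_mem_left _ _ hf⟩
  choose p hp hp0 hpL using hcen
  refine ⟨_, hS.1, ∏ k, p k, prod_mem fun k _ => hp k, Finset.prod_ne_zero_iff.mpr
    fun k _ => hp0 k, ?_⟩
  rw [← he.mul_sum (ofPoly σ _)]
  refine sum_mem fun k _ => ?_
  rw [← Finset.prod_erase_mul _ _ (Finset.mem_univ k), map_mul, mul_assoc]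
  exact Ideal.mul_mem_left _ _ (hpL k)

omit [Fintype ι] in
theorem IsIdemBasis.mem {N : Ideal (SkewPoly σ)} {κ : Type*} [Fintype κ] {l : κ → ι}
    {f : κ → SkewPoly σ} (hf : IsIdemBasis e N l f) (i : κ) : f i ∈ N := by
  classical
  refine (hf.mem_iff _).mpr ⟨Pi.single i 1, ?_⟩
  rw [Finset.sum_eq_single i]
  · simp
  · intro j _ hj
    simp [hj]
  · simp

/-- Right multiplication by `b` has kernel `I` and a projective image; the complement of `I` is the
image of a section. -/
theorem IsFieldSystem.isComplemented_of_saturated [Finite A] (he : IsFieldSystem e)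
    (I : Ideal (SkewPoly σ))
    (hI : ∀ p : F[X], p ≠ 0 → ∀ f, ofPoly σ p * f ∈ I → f ∈ I) : IsComplemented I := by
  obtain ⟨J, hJ, p, hp, hp0, hpL⟩ := he.exists_disjoint_of_forall I
  obtain ⟨a, ha, b, hb, hab⟩ := Submodule.mem_sup.mp hpL
  have hker : ∀ r, r * b = 0 ↔ r ∈ I := by
    intro r
    have h1 : r * a + r * b = ofPoly σ p * r := by
      rw [← mul_add, hab, comm_of_mem_centralPolys hp]
    constructor
    · intro h
      refine hI p hp0 r ?_
      rw [← h1, h, add_zero]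
      exact I.mul_mem_left _ ha
    · intro h
      refine Submodule.disjoint_def.mp hJ _ ?_ (J.mul_mem_left _ hb)
      rw [← eq_sub_iff_add_eq'] at h1
      rw [h1]
      exact I.sub_mem (I.mul_mem_left _ h) (I.mul_mem_left _ ha)
  obtain ⟨κ, _, l, f, hf⟩ := he.exists_isIdemBasis
    (LinearMap.range (LinearMap.toSpanSingleton (SkewPoly σ) (SkewPoly σ) b))
  -- The section sends the generator `f i` to `s i`. Requiring `s i = e_(l i) s i` makes it well
  -- defined, as the annihilator of `f i` kills `e_(l i)`.
  have hs : ∀ i, ∃ s : SkewPoly σ, C σ (e (l i)) * s = s ∧ s * b = f i := by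
    intro i
    obtain ⟨s, hs⟩ := hf.mem i
    refine ⟨C σ (e (l i)) * s, by rw [← mul_assoc, he.C_mul_self], ?_⟩
    rw [mul_assoc]
    exact (congrArg _ hs).trans (hf.C_mul i)
  choose s hs hsb using hs
  have hsum : ∀ r : κ → SkewPoly σ, (∑ i, r i * s i) * b = ∑ i, r i * f i := fun r => by
    rw [Finset.sum_mul]
    exact Finset.sum_congr rfl fun i _ => by rw [mul_assoc, hsb]
  refine ⟨Ideal.span (Set.range s), Submodule.disjoint_def.mpr ?_,
    codisjoint_iff.mpr (eq_top_iff.mpr ?_)⟩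
  · intro x hx hx'
    obtain ⟨r, rfl⟩ := (Submodule.mem_span_range_iff_exists_fun _).mp hx'
    simp only [smul_eq_mul] at hx ⊢
    have h := hf.indep r ((hsum r).symm.trans ((hker _).mpr hx))
    refine Finset.sum_eq_zero fun i _ => ?_
    rw [← hs i, ← mul_assoc, h i, zero_mul]
  · intro x _
    obtain ⟨r, hr⟩ := (hf.mem_iff (x * b)).mp ⟨x, rfl⟩
    have hx : x = (x - ∑ i, r i * s i) + ∑ i, r i * s i := by abel
    rw [hx]
    refine Submodule.add_mem_sup ((hker _).mp ?_)
      ((Submodule.mem_span_range_iff_exists_fun _).mpr ⟨r, rfl⟩)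
    rw [sub_mul, hsum, hr, sub_self]

theorem IsFieldSystem.isComplemented_restrictScalars_iff [Finite A] (he : IsFieldSystem e)
    (I : Ideal (SkewPoly σ)) : IsComplemented (I.restrictScalars F[X]) ↔ IsComplemented I :=
  ⟨fun h => he.isComplemented_of_saturated I fun _ hp _ hf => mem_of_ofPoly_mul_mem h hp hf,
    fun ⟨J, hJ⟩ => ⟨J.restrictScalars F[X], isCompl_restrictScalars hJ⟩⟩

/-! ### Decompositions of the whole ring and units -/

omit [Fintype ι] in
theorem IsIdemBasis.sumElim {I J : Ideal (SkewPoly σ)} (hIJ : IsCompl I J) {κ κ' : Type*}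
    [Fintype κ] [Fintype κ'] {l : κ → ι} {f : κ → SkewPoly σ} {l' : κ' → ι}
    {f' : κ' → SkewPoly σ} (hf : IsIdemBasis e I l f) (hf' : IsIdemBasis e J l' f') :
    IsIdemBasis e (⊤ : Ideal (SkewPoly σ)) (Sum.elim l l') (Sum.elim f f') where
  C_mul := by
    rintro (i | i)
    · exact hf.C_mul i
    · exact hf'.C_mul i
  mem_iff x := by
    refine ⟨fun _ => ?_, fun _ => trivial⟩
    have hx : x ∈ I ⊔ J := by rw [hIJ.sup_eq_top]; trivial
    obtain ⟨a, ha, b, hb, rfl⟩ := Submodule.mem_sup.mp hx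
    obtain ⟨r, rfl⟩ := (hf.mem_iff a).mp ha
    obtain ⟨r', rfl⟩ := (hf'.mem_iff b).mp hb
    exact ⟨Sum.elim r r', by simp⟩
  indep r hr := by
    simp only [Fintype.sum_sum_type, Sum.elim_inl, Sum.elim_inr] at hr
    have hI : ∑ i, r (Sum.inl i) * f i ∈ I := (hf.mem_iff _).mpr ⟨fun i => r (Sum.inl i), rfl⟩
    have hJ : ∑ i, r (Sum.inr i) * f' i ∈ J := (hf'.mem_iff _).mpr ⟨fun i => r (Sum.inr i), rfl⟩
    have h0 : ∑ i, r (Sum.inl i) * f i = 0 := by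
      refine Submodule.disjoint_def.mp hIJ.disjoint _ hI ?_
      rw [eq_neg_of_add_eq_zero_left hr]
      exact J.neg_mem hJ
    rw [h0, zero_add] at hr
    rintro (i | i)
    · exact hf.indep _ h0 i
    · exact hf'.indep _ hr i

variable {κ : Type*} [Fintype κ] {l : κ → ι} {f : κ → SkewPoly σ}

-- Reduction modulo `z` preserves independence: if `∑ c_i f_i = z g`, expand `g = ∑ r_i f_i`, apply
-- independence to `c_i - z r_i`, and take constant coefficients.
omit [Fintype ι] in
theorem IsIdemBasis.mul_eq_zero_of_top (hf : IsIdemBasis e (⊤ : Ideal (SkewPoly σ)) l f)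
    (c : κ → A) (hc : ∑ i, c i * (f i).coeff 0 = 0) (i : κ) : c i * e (l i) = 0 := by
  obtain ⟨g, hg⟩ := exists_eq_z_mul (f := ∑ i, C σ (c i) * f i) (by
    rw [coeff_sum, ← hc]
    exact Finset.sum_congr rfl fun i _ => by rw [mul_coeff_zero, coeff_C_zero])
  obtain ⟨r, rfl⟩ := (hf.mem_iff g).mp trivial
  have h := hf.indep (fun i => C σ (c i) - z σ * r i) (by
    simp only [sub_mul, mul_assoc, Finset.sum_sub_distrib]
    rw [hg, Finset.mul_sum, sub_self]) i
  have h0 := congrArg (fun x : SkewPoly σ => x.coeff 0) h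
  simp only [mul_coeff_zero, coeff_sub, coeff_C_zero, coeff_zero] at h0
  simpa [z, coeff_monomial] using h0

/-- The constant coefficients decompose `A` itself, where each one-dimensional `A e_k` has room for
exactly one summand. -/
theorem IsIdemBasis.bijective_of_top (he : IsFieldSystem e)
    (hf : IsIdemBasis e (⊤ : Ideal (SkewPoly σ)) l f) : Function.Bijective l := by
  classical
  have hcoeff : ∀ i, e (l i) * (f i).coeff 0 = (f i).coeff 0 := fun i => by
    have h := congrArg (fun x : SkewPoly σ => x.coeff 0) (hf.C_mul i)
    simpa only [mul_coeff_zero, coeff_C_zero] using h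
  constructor
  · intro i j hij
    by_contra hne
    -- Commutativity of `A` gives the relation `f_j(0) f_i(0) - f_i(0) f_j(0) = 0`, which forces
    -- `f_j(0) = 0`.
    have h1 := hf.mul_eq_zero_of_top
      (Pi.single i ((f j).coeff 0) - Pi.single j ((f i).coeff 0)) (by
        simp only [Pi.sub_apply, sub_mul, Finset.sum_sub_distrib, Pi.single_apply, ite_mul,
          zero_mul, Finset.sum_ite_eq', Finset.mem_univ, if_true]
        ring) i
    have h2 : (f j).coeff 0 = 0 := by
      rw [← hcoeff j, ← hij, mul_comm]
      simpa [hne] using h1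
    have h3 := hf.mul_eq_zero_of_top (Pi.single j 1) (by
        rw [Finset.sum_eq_single j]
        · rw [h2, mul_zero]
        · intro m _ hm
          simp [hm]
        · simp) j
    rw [Pi.single_eq_same, one_mul] at h3
    exact he.ne_zero _ h3
  · intro k
    by_contra! hk
    obtain ⟨r, hr⟩ := (hf.mem_iff 1).mp trivial
    have h1 := congrArg (fun x : SkewPoly σ => x.coeff 0 * e k) hr
    simp only [coeff_sum, mul_coeff_zero, Finset.sum_mul] at h1
    rw [Finset.sum_eq_zero] at h1
    · refine he.ne_zero k ?_
      rw [← h1, ← map_one (C σ), coeff_C_zero, one_mul]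
    · intro i _
      rw [← hcoeff i]
      linear_combination ((r i).coeff 0 * (f i).coeff 0) * he.ortho (hk i)

/-- The unit is `∑ f_j`, whose component at `l i` is `f i` by injectivity of `l`. Expanding `1` in
the basis gives a left inverse; independence makes right multiplication by the sum injective, so the
inverse is two-sided. -/
theorem IsIdemBasis.exists_unit_of_top (he : IsFieldSystem e)
    (hf : IsIdemBasis e (⊤ : Ideal (SkewPoly σ)) l f) :
    ∃ u : (SkewPoly σ)ˣ, ∀ i, C σ (e (l i)) * u = f i := by
  have hl := hf.bijective_of_top he
  have hu : ∀ i, C σ (e (l i)) * ∑ j, f j = f i := by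
    intro i
    rw [Finset.mul_sum, Finset.sum_eq_single i]
    · exact hf.C_mul i
    · intro j _ hj
      rw [← hf.C_mul j, ← mul_assoc, he.C_mul_of_ne (fun h => hj (hl.1 h).symm), zero_mul]
    · simp
  obtain ⟨r, hr⟩ := (hf.mem_iff 1).mp trivial
  have hvu : (∑ i, r i * C σ (e (l i))) * ∑ j, f j = 1 := by
    rw [hr, Finset.sum_mul]
    exact Finset.sum_congr rfl fun i _ => by rw [mul_assoc, hu]
  have hreg : ∀ x, x * ∑ j, f j = 0 → x = 0 := by
    intro x hx
    have h := hf.indep (fun _ => x) (by rwa [← Finset.mul_sum])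
    rw [← he.mul_sum x]
    refine Finset.sum_eq_zero fun k _ => ?_
    obtain ⟨i, rfl⟩ := hl.2 k
    exact h i
  refine ⟨⟨∑ j, f j, ∑ i, r i * C σ (e (l i)), ?_, hvu⟩, hu⟩
  rw [← sub_eq_zero]
  refine hreg _ ?_
  rw [sub_mul, mul_assoc, hvu, mul_one, one_mul, sub_self]

/-! ### Left ideals generated by components of a unit -/

theorem IsFieldSystem.C_mul_sum (he : IsFieldSystem e) [DecidableEq ι] (T : Finset ι) (k : ι)
    (u : SkewPoly σ) :
    C σ (e k) * ∑ j ∈ T, C σ (e j) * u = if k ∈ T then C σ (e k) * u else 0 := by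
  have h : ∀ j ∈ T, C σ (e k) * (C σ (e j) * u) = if k = j then C σ (e k) * u else 0 := by
    intro j _
    rw [← mul_assoc]
    split_ifs with h
    · rw [← h, he.C_mul_self]
    · rw [he.C_mul_of_ne h, zero_mul]
  rw [Finset.mul_sum, Finset.sum_congr rfl h, Finset.sum_ite_eq]

theorem IsFieldSystem.exists_unit_of_isComplemented (he : IsFieldSystem e)
    {I : Ideal (SkewPoly σ)} (hI : IsComplemented I) :
    ∃ (u : (SkewPoly σ)ˣ) (T : Finset ι),
      I = Ideal.span {∑ k ∈ T, C σ (e k) * (u : SkewPoly σ)} := by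
  classical
  obtain ⟨J, hIJ⟩ := hI
  obtain ⟨κ, _, l, f, hf⟩ := he.exists_isIdemBasis I
  obtain ⟨κ', _, l', f', hf'⟩ := he.exists_isIdemBasis J
  obtain ⟨u, hu⟩ := (hf.sumElim hIJ hf').exists_unit_of_top he
  refine ⟨u, Finset.univ.image l, le_antisymm (fun x hx => ?_)
    ((Ideal.span_singleton_le_iff_mem I).mpr (I.sum_mem fun k hk => ?_))⟩
  · obtain ⟨r, rfl⟩ := (hf.mem_iff x).mp hx
    refine sum_mem fun i _ => Ideal.mul_mem_left _ _ ?_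
    refine Ideal.mem_span_singleton'.mpr ⟨C σ (e (l i)), ?_⟩
    rw [he.C_mul_sum, if_pos (Finset.mem_image_of_mem l (Finset.mem_univ i))]
    exact hu (Sum.inl i)
  · obtain ⟨i, -, rfl⟩ := Finset.mem_image.mp hk
    have h := hu (Sum.inl i)
    simp only [Sum.elim_inl] at h
    rw [h]
    exact hf.mem i

theorem IsFieldSystem.C_mul_unit_ne_zero (he : IsFieldSystem e) (u : (SkewPoly σ)ˣ) (k : ι) :
    C σ (e k) * (u : SkewPoly σ) ≠ 0 := by
  intro h
  refine he.ne_zero k ?_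
  rw [← coeff_C_zero (σ := σ) (e k), u.mul_left_eq_zero.mp h, coeff_zero]

/-- For `u = 1` this is the splitting of the ring by complementary idempotents; right multiplication
by `u` is an automorphism of the left module. -/
theorem IsFieldSystem.isCompl_span (he : IsFieldSystem e) [DecidableEq ι] (u : (SkewPoly σ)ˣ)
    (T : Finset ι) :
    IsCompl (Ideal.span {∑ k ∈ T, C σ (e k) * (u : SkewPoly σ)})
      (Ideal.span {∑ k with k ∉ T, C σ (e k) * (u : SkewPoly σ)}) := by
  refine ⟨Submodule.disjoint_def.mpr fun x hx hx' => ?_,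
    codisjoint_iff.mpr (eq_top_iff.mpr fun x _ => ?_)⟩
  · obtain ⟨a, ha⟩ := Ideal.mem_span_singleton'.mp hx
    obtain ⟨b, hb⟩ := Ideal.mem_span_singleton'.mp hx'
    rw [← Finset.sum_mul, ← mul_assoc] at ha hb
    have h := u.mul_left_inj.mp (ha.trans hb.symm)
    have h1 : (∑ k ∈ T, C σ (e k)) * ∑ k ∈ T, C σ (e k) = ∑ k ∈ T, C σ (e k) := by
      rw [Finset.sum_mul]
      refine Finset.sum_congr rfl fun k hk => ?_
      simpa [hk] using he.C_mul_sum T k 1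
    have h2 : (∑ k with k ∉ T, C σ (e k)) * ∑ k ∈ T, C σ (e k) = 0 := by
      rw [Finset.sum_mul]
      refine Finset.sum_eq_zero fun k hk => ?_
      simpa [(Finset.mem_filter.mp hk).2] using he.C_mul_sum T k 1
    rw [← ha, ← h1, ← mul_assoc, h, mul_assoc b, h2, mul_zero, zero_mul]
  · have h : ∑ k ∈ T, C σ (e k) * (u : SkewPoly σ) +
        ∑ k with k ∉ T, C σ (e k) * (u : SkewPoly σ) = u := by
      have h1 := Finset.sum_filter_add_sum_filter_not Finset.univ (· ∈ T)
        fun k => C σ (e k) * (u : SkewPoly σ)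
      rw [he.sum_mul, Finset.filter_univ_mem] at h1
      exact h1
    have hx : x = x * ↑u⁻¹ * ∑ k ∈ T, C σ (e k) * (u : SkewPoly σ) +
        x * ↑u⁻¹ * ∑ k with k ∉ T, C σ (e k) * (u : SkewPoly σ) := by
      rw [← mul_add, h, mul_assoc, u.inv_mul, mul_one]
    rw [hx]
    exact Submodule.add_mem_sup
      (Ideal.mul_mem_left _ _ (Ideal.mem_span_singleton_self _))
      (Ideal.mul_mem_left _ _ (Ideal.mem_span_singleton_self _))

end Ideals

end SkewPoly

/-! ### Transfer to `F[z]^n` and to the idempotents of `F[x]/(x^n - 1)` -/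

section CyclicCodes

open SkewPoly

variable {F : Type*} [Field F] {n : ℕ}

theorem X_pow_sub_one_monic (hn : 0 < n) : (X ^ n - 1 : F[X]).Monic :=
  monic_X_pow_sub_C 1 hn.ne'

theorem exists_basis_pow_root (hn : 0 < n) :
    ∃ b : Module.Basis (Fin n) F (CycAlg F n),
      ∀ i, b i = AdjoinRoot.root (X ^ n - 1 : F[X]) ^ (i : ℕ) := by
  have hdim : (AdjoinRoot.powerBasis' (X_pow_sub_one_monic (F := F) hn)).dim = n := by
    rw [AdjoinRoot.powerBasis'_dim]
    exact natDegree_X_pow_sub_C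
  refine ⟨(AdjoinRoot.powerBasis' (X_pow_sub_one_monic (F := F) hn)).basis.reindex
    (finCongr hdim), fun i => ?_⟩
  rw [Module.Basis.reindex_apply, PowerBasis.basis_eq_pow, AdjoinRoot.powerBasis'_gen]
  rfl

theorem toSkew_bijective (hn : 0 < n) (σ : CycAlg F n ≃ₐ[F] CycAlg F n) :
    Function.Bijective (toSkew σ) := by
  obtain ⟨b, hb⟩ := exists_basis_pow_root (F := F) hn
  have hcoeff : ∀ v j, (toSkew σ v).coeff j = ∑ i, (v i).coeff j • b i := fun v j => by
    rw [coeff_toSkew]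
    exact Finset.sum_congr rfl fun i _ => by rw [hb]
  constructor
  · rw [injective_iff_map_eq_zero]
    intro v hv
    funext i
    refine Polynomial.ext fun j => ?_
    have h := hcoeff v j
    rw [hv, SkewPoly.coeff_zero] at h
    exact Fintype.linearIndependent_iff.mp b.linearIndependent _ h.symm i
  · intro f
    induction f using SkewPoly.induction with
    | hadd f g hf hg =>
      obtain ⟨v, rfl⟩ := hf
      obtain ⟨w, rfl⟩ := hg
      exact ⟨v + w, map_add _ _ _⟩
    | hmon j a =>
      refine ⟨fun i => Polynomial.monomial j (b.repr a i), SkewPoly.ext fun m => ?_⟩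
      rw [hcoeff, SkewPoly.coeff_monomial]
      simp only [Polynomial.coeff_monomial]
      split_ifs
      · exact b.sum_repr a
      · simp

/-- The isomorphism `toSkew` identifies the submodule lattices over `F[z]`, so a left ideal
complement pulls back to a `σ`-cyclic one. -/
theorem IsSigmaCyclicCode.exists_isCompl (hn : 0 < n) {σ : CycAlg F n ≃ₐ[F] CycAlg F n}
    (h : ∀ I : Ideal (SkewPoly σ), IsComplemented (I.restrictScalars F[X]) → IsComplemented I)
    {S : Submodule F[X] (Fin n → F[X])} (hS : IsSigmaCyclicCode σ S) :
    ∃ S' : Submodule F[X] (Fin n → F[X]), IsSigmaCyclicCode σ S' ∧ IsCompl S S' := by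
  obtain ⟨⟨N, hN⟩, I, hI⟩ := hS
  set L := LinearEquiv.ofBijective (toSkew σ) (toSkew_bijective hn σ) with hL
  have hIS : Submodule.orderIsoMapComap L S = I.restrictScalars F[X] :=
    SetLike.coe_injective hI.symm
  obtain ⟨J, hJ⟩ := h I ⟨_, hIS ▸ OrderIso.isCompl (Submodule.orderIsoMapComap L) hN⟩
  set S' := (Submodule.orderIsoMapComap L).symm (J.restrictScalars F[X]) with hS'
  have hJS : Submodule.orderIsoMapComap L S' = J.restrictScalars F[X] :=
    OrderIso.apply_symm_apply _ _
  have hc : IsCompl S S' := by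
    rw [OrderIso.isCompl_iff (Submodule.orderIsoMapComap L), hIS, hJS]
    exact isCompl_restrictScalars hJ
  exact ⟨S', ⟨⟨S, hc.symm⟩, J, (congrArg SetLike.coe hJS).symm⟩, hc⟩

variable [Fintype F]

theorem pos_of_coprime_card (hn : n.Coprime (Fintype.card F)) : 0 < n := by
  rcases Nat.eq_zero_or_pos n with rfl | h
  · have := Fintype.one_lt_card (α := F)
    simp at hn
    omega
  · exact h

theorem isFieldSystem_idem (hn : n.Coprime (Fintype.card F)) :
    SkewPoly.IsFieldSystem (idem hn) := by
  set ψ := RingEquiv.ofBijective (crt F n) (crt_bijective hn) with hψ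
  have he : ∀ k, idem hn k = ψ.symm (Pi.single k 1) := fun k => rfl
  have hirr : ∀ k : factors F n, Irreducible (k : F[X]) := fun k =>
    ((mem_factors (pos_of_coprime_card hn) _).mp k.2).2.1
  refine { (CompleteOrthogonalIdempotents.single
    fun k : factors F n => AdjoinRoot (k : F[X])).map ψ.symm.toRingHom with
    ne_zero := fun k h => ?_
    exists_mul_eq := fun k a ha => ?_ }
  · have := Fact.mk (hirr k)
    rw [he, map_eq_zero_iff _ ψ.symm.injective, Pi.single_eq_zero_iff] at h
    exact one_ne_zero h
  · have := Fact.mk (hirr k)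
    have hak : ψ a k ≠ 0 := by
      intro h
      refine ha (ψ.injective ?_)
      rw [map_mul, he, RingEquiv.apply_symm_apply, map_zero]
      funext j
      by_cases hj : j = k
      · subst hj
        simp [h]
      · simp [hj]
    refine ⟨ψ.symm (Pi.single k (ψ a k)⁻¹), ψ.injective ?_⟩
    rw [map_mul, he, RingEquiv.apply_symm_apply, RingEquiv.apply_symm_apply]
    funext j
    by_cases hj : j = k
    · subst hj
      simp [hak]
    · simp [hj]

theorem finite_cycAlg (hn : 0 < n) : Finite (CycAlg F n) := by
  have := (X_pow_sub_one_monic (F := F) hn).finite_adjoinRoot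
  exact Module.finite_of_finite F

theorem mem_support (hn : n.Coprime (Fintype.card F)) {σ : CycAlg F n ≃ₐ[F] CycAlg F n}
    (f : SkewPoly σ) (k : factors F n) :
    k ∈ support hn f ↔ SkewPoly.C σ (idem hn k) * f ≠ 0 := by
  classical
  exact Finset.mem_filter_univ k

theorem support_sum_component (hn : n.Coprime (Fintype.card F))
    {σ : CycAlg F n ≃ₐ[F] CycAlg F n} (u : (SkewPoly σ)ˣ) (T : Finset (factors F n)) :
    support hn (∑ k ∈ T, component hn (u : SkewPoly σ) k) = T := by
  have he := isFieldSystem_idem hn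
  ext k
  rw [mem_support]
  simp only [component, he.C_mul_sum]
  split_ifs with hk
  · simp [hk, he.C_mul_unit_ne_zero u k]
  · simp [hk]

end CyclicCodes

end Piret

theorem mainTheorem5 {F : Type*} [Field F] [Fintype F] (n : ℕ)
    (hn : n.Coprime (Fintype.card F)) (σ : Piret.CycAlg F n ≃ₐ[F] Piret.CycAlg F n) :
    (∀ I : Ideal (Piret.SkewPoly σ),
      (IsComplemented (I.restrictScalars F[X]) ↔ IsComplemented I) ∧
      (IsComplemented I →
        (∃ (u : (Piret.SkewPoly σ)ˣ) (g : Piret.SkewPoly σ),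
          I = Ideal.span {g} ∧
          g = ∑ l ∈ Piret.support hn g, Piret.component hn (u : Piret.SkewPoly σ) l) ∧
        (∀ (u : (Piret.SkewPoly σ)ˣ) (g : Piret.SkewPoly σ),
          I = Ideal.span {g} →
          g = ∑ l ∈ Piret.support hn g, Piret.component hn (u : Piret.SkewPoly σ) l →
          IsCompl I (Ideal.span
            {∑ l with l ∉ Piret.support hn g, Piret.component hn (u : Piret.SkewPoly σ) l})))) ∧
    (∀ S : Submodule F[X] (Fin n → F[X]), Piret.IsSigmaCyclicCode σ S →
      ∃ S' : Submodule F[X] (Fin n → F[X]), Piret.IsSigmaCyclicCode σ S' ∧ IsCompl S S') := by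
  have hn0 := Piret.pos_of_coprime_card hn
  have he := Piret.isFieldSystem_idem hn
  have := Piret.finite_cycAlg (F := F) hn0
  have hiff : ∀ I : Ideal (Piret.SkewPoly σ),
      IsComplemented (I.restrictScalars F[X]) ↔ IsComplemented I :=
    he.isComplemented_restrictScalars_iff
  refine ⟨fun I => ⟨hiff I, fun hI => ⟨?_, fun u g hIg hg => ?_⟩⟩,
    fun S hS => hS.exists_isCompl hn0 fun I => (hiff I).mp⟩
  · obtain ⟨u, T, hT⟩ := he.exists_unit_of_isComplemented hI
    refine ⟨u, _, hT, ?_⟩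
    exact (congrArg (fun T => ∑ l ∈ T, Piret.component hn (u : Piret.SkewPoly σ) l)
      (Piret.support_sum_component hn u T)).symm
  · rw [hIg]
    -- Only the generator is expanded; the `g` inside the support has to stay.
    nth_rewrite 1 [hg]
    exact he.isCompl_span u (Piret.support hn g)
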